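/- Let $n$ be a natural number, $\mathbb{D}^n=\{z\in\mathbb{C}^n:|z_i|<1 \text{ for all } i\}$, $\overline{\mathbb{D}^n}=\{z\in\mathbb{C}^n:|z_i|\le 1\text{ for all } i\}$, $\mathbb{T}^n=\{z\in\mathbb{C}^n:|z_i|=1\text{ for all } i\}$ and $\mathbb{T}=\mathbb{T}^1$. Let the polydisk algebra $A(\mathbb{D}^n)$ be the ring of all functions $f:\overline{\mathbb{D}^n}\to\mathbb{C}$ that are continuous on $\overline{\mathbb{D}^n}$ and holomorphic in $\mathbb{D}^n$. Let $R$ be a unital full subring of $A(\mathbb{D}^n)$, i.e. a unital subring such that every $x\in R$ that is invertible in $A(\mathbb{D}^n)$ is invertible in $R$. Let $S=C(\mathbb{T}^n)\times C(\mathbb{T})$ with pointwise operations, the norm $\|(g,h)\|=\max\{\|g\|_\infty,\|h\|_\infty\}$ and the involution $(g,h)^*=(\overline g,\overline h)$; write $\operatorname{inv} S$ for its set of invertible elements. Map $R$ into $S$ by $j(f)=\bigl(f|_{\mathbb{T}^n},\ z\mapsto f(z,\dots,z)\bigr)$. Let $\iota:\operatorname{inv} S\to G=\mathbb{Z}$ be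 $\iota(g,h)=\mathtt{w}(h)$, where the winding number of an invertible $h\in C(\mathbb{T})$ is $\mathtt{w}(h)=\frac{1}{2\pi}(\Theta(2\pi)-\Theta(0))\in\mathbb{Z}$ for any continuous $\Theta:[0,2\pi]\to\mathbb{R}$ with $h(e^{it})=|h(e^{it})|e^{i\Theta(t)}$ for $t\in[0,2\pi]$. Then: (A1) $R$ is a commutative integral domain with identity. (A2) $S$ is a unital commutative complex semisimple Banach algebra, ${}^*$ is an involution on it, and $j$ is an injective unital ring homomorphism, so that $R$ may be regarded as a subring of $S$. (A3) For all $a,b\in\operatorname{inv} S$: (I1) $\iota(ab)=\iota(a)+\iota(b)$; (I2) $\iota(a^*)=-\iota(a)$; (I3) $\iota$ is locally constant on $\operatorname{inv} S$ (with the norm topology of $S$). (A4) For every $x\in R$ with $j(x)\in\operatorname{inv} S$: $x$ is invertible in $R$ if and only if $\iota(j(x))=0$. -/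

import Mathlib

noncomputable section

namespace PolydiskIndex

/-! ### The abstract setup -/

/-- A subring `R` of a commutative ring `A` is full if each of its elements that is invertible
in `A` is already invertible in `R`. (A `Subring` contains the identity of the ambient ring.) -/
def IsFullSubring {A : Type*} [CommRing A] (R : Subring A) : Prop :=
  ∀ x : R, IsUnit (x : A) → IsUnit x

/-- The assumptions (A1)-(A4) on a commutative ring `R` that is regarded as a subring of a
commutative normed complex `*`-ring `S` through a ring homomorphism `j`, and on an index
`ι : inv S → G` with values in an abelian group `G`.
The involution of `S` is the operation `star`, an involutive ring (anti-)automorphism. -/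
structure SatisfiesA1A4 {R S G : Type*} [CommRing R] [NormedCommRing S] [NormedAlgebra ℂ S]
    [StarRing S] [AddCommGroup G] (j : R →+* S) (ι : Sˣ → G) : Prop where
  /-- (A1): `R` is an integral domain. -/
  a1 : IsDomain R
  /-- (A2): `S` is complete, hence a Banach algebra. -/
  a2_complete : CompleteSpace S
  /-- (A2): the identity of `S` has norm one. -/
  a2_norm_one : ‖(1 : S)‖ = 1
  /-- (A2): `S` is semisimple, that is, its Jacobson radical is zero. -/
  a2_semisimple : Ring.jacobson S = ⊥
  /-- (A2): the involution is conjugate linear. -/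
  a2_star_smul : ∀ (c : ℂ) (a : S), star (c • a) = (starRingEnd ℂ) c • star a
  /-- (A2): `R` is a subring of `S`. -/
  a2_injective : Function.Injective j
  /-- (A3)(I1). -/
  a3_mul : ∀ a b : Sˣ, ι (a * b) = ι a + ι b
  /-- (A3)(I2). -/
  a3_star : ∀ a : Sˣ, ι (star a) = -ι a
  /-- (A3)(I3): `ι` is locally constant on `inv S`, a subset of the normed space `S`. -/
  a3_locallyConstant : ∀ a : Sˣ, ∃ ε > 0, ∀ b : Sˣ, ‖(b : S) - (a : S)‖ < ε → ι b = ι a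
  /-- (A4): an element of `R` that is invertible in `S` is invertible in `R` iff its index
  is zero. -/
  a4 : ∀ (x : R) (u : Sˣ), (u : S) = j x → (IsUnit x ↔ ι u = 0)

/-! ### The winding number -/

/-- `Θ` is a continuous argument of `t ↦ f (e ^ (i t))` on `[0, 2π]`. -/
def IsContinuousArgument (f : C(Circle, ℂ)) (Θ : ℝ → ℝ) : Prop :=
  ContinuousOn Θ (Set.Icc 0 (2 * Real.pi)) ∧
    ∀ t ∈ Set.Icc (0 : ℝ) (2 * Real.pi),
      f (Circle.exp t) = (‖f (Circle.exp t)‖ : ℂ) * Complex.exp (Complex.I * (Θ t : ℂ))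

theorem unit_apply_ne_zero (f : C(Circle, ℂ)ˣ) (z : Circle) : (f : C(Circle, ℂ)) z ≠ 0 := by
  intro h
  have h1 : (f : C(Circle, ℂ)) z * (↑f⁻¹ : C(Circle, ℂ)) z = 1 :=
    congrArg (fun g : C(Circle, ℂ) => g z) f.mul_inv
  rw [h, zero_mul] at h1
  exact zero_ne_one h1

theorem exists_isContinuousArgument (f : C(Circle, ℂ)ˣ) :
    ∃ Θ : ℝ → ℝ, IsContinuousArgument f Θ := by
  have hne : ∀ t : ℝ, (f : C(Circle, ℂ)) (Circle.exp t) ≠ 0 :=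
    fun t => unit_apply_ne_zero f _
  let g : C(ℝ, Circle) :=
    ⟨fun t => ⟨(f : C(Circle, ℂ)) (Circle.exp t) / (‖(f : C(Circle, ℂ)) (Circle.exp t)‖ : ℂ), by
      have := hne t
      simp [Submonoid.unitSphere, this]⟩, by
      refine Continuous.subtype_mk (Continuous.div ?_ ?_ ?_) _
      · fun_prop
      · fun_prop
      · intro t
        simpa using hne t⟩
  obtain ⟨a, ha⟩ := Circle.exp_surjective (g 0)
  obtain ⟨F, ⟨-, hF⟩, -⟩ :=
    Circle.isCoveringMap_exp.existsUnique_continuousMap_lifts g (a₀ := 0) (e₀ := a) ha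
  refine ⟨F, F.continuous.continuousOn, fun t _ => ?_⟩
  have h1 : Circle.exp (F t) = g t := congrFun hF t
  have h2 := congrArg (fun z : Circle => (z : ℂ)) h1
  simp only [Circle.coe_exp] at h2
  rw [mul_comm Complex.I, h2]
  have hn : (‖(f : C(Circle, ℂ)) (Circle.exp t)‖ : ℂ) ≠ 0 := by simpa using hne t
  change _ = _ * (_ / _)
  rw [mul_div_cancel₀ _ hn]

theorem exists_int_of_isContinuousArgument (f : C(Circle, ℂ)ˣ) {Θ : ℝ → ℝ}
    (h : IsContinuousArgument f Θ) :
    ∃ k : ℤ, (k : ℝ) = 1 / (2 * Real.pi) * (Θ (2 * Real.pi) - Θ 0) := by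
  have hpi := Real.pi_pos
  have h0 := h.2 0 ⟨le_rfl, by positivity⟩
  have h1 := h.2 (2 * Real.pi) ⟨by positivity, le_rfl⟩
  rw [Circle.exp_two_pi] at h1
  rw [Circle.exp_zero] at h0
  have hne : (‖(f : C(Circle, ℂ)) 1‖ : ℂ) ≠ 0 := by
    simpa using unit_apply_ne_zero f 1
  have h2 := mul_left_cancel₀ hne (h1.symm.trans h0)
  obtain ⟨k, hk⟩ := Complex.exp_eq_exp_iff_exists_int.1 h2
  refine ⟨k, ?_⟩
  have h3 : ((Θ (2 * Real.pi) : ℝ) : ℂ) = ((Θ 0 + k * (2 * Real.pi) : ℝ) : ℂ) := by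
    apply mul_left_cancel₀ Complex.I_ne_zero
    rw [hk]; push_cast; ring
  have h4 : Θ (2 * Real.pi) = Θ 0 + k * (2 * Real.pi) := by exact_mod_cast h3
  rw [h4]; field_simp; ring

theorem exists_windingNumber (f : C(Circle, ℂ)ˣ) :
    ∃ k : ℤ, ∃ Θ : ℝ → ℝ, IsContinuousArgument f Θ ∧
      (k : ℝ) = 1 / (2 * Real.pi) * (Θ (2 * Real.pi) - Θ 0) := by
  obtain ⟨Θ, hΘ⟩ := exists_isContinuousArgument f
  obtain ⟨k, hk⟩ := exists_int_of_isContinuousArgument f hΘ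
  exact ⟨k, Θ, hΘ, hk⟩

/-- The winding number of an invertible element of `C(𝕋)`:
`(Θ(2π) - Θ(0)) / (2π)` for a continuous argument `Θ`. -/
def windingNumber (f : C(Circle, ℂ)ˣ) : ℤ := (exists_windingNumber f).choose

/-- The winding number does not depend on the continuous argument. -/
theorem windingNumber_eq (f : C(Circle, ℂ)ˣ) {Θ : ℝ → ℝ} (h : IsContinuousArgument f Θ) :
    (windingNumber f : ℝ) = 1 / (2 * Real.pi) * (Θ (2 * Real.pi) - Θ 0) := by
  obtain ⟨Φ, hΦ, hk⟩ := (exists_windingNumber f).choose_spec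
  have hpi := Real.pi_pos
  have hint : ∀ t ∈ Set.Icc (0 : ℝ) (2 * Real.pi),
      ∃ m : ℤ, (m : ℝ) = (Θ t - Φ t) / (2 * Real.pi) := by
    intro t ht
    have hne : (‖(f : C(Circle, ℂ)) (Circle.exp t)‖ : ℂ) ≠ 0 := by
      simpa using unit_apply_ne_zero f (Circle.exp t)
    have h2 := mul_left_cancel₀ hne ((h.2 t ht).symm.trans (hΦ.2 t ht))
    obtain ⟨m, hm⟩ := Complex.exp_eq_exp_iff_exists_int.1 h2
    refine ⟨m, ?_⟩
    have h3 : ((Θ t : ℝ) : ℂ) = ((Φ t + m * (2 * Real.pi) : ℝ) : ℂ) := by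
      apply mul_left_cancel₀ Complex.I_ne_zero
      rw [hm]; push_cast; ring
    have h4 : Θ t = Φ t + m * (2 * Real.pi) := by exact_mod_cast h3
    rw [h4]; field_simp; ring
  have hcont : ContinuousOn (fun t => (Θ t - Φ t) / (2 * Real.pi))
      (Set.Icc 0 (2 * Real.pi)) := (h.1.sub hΦ.1).div_const _
  have hmaps : Set.MapsTo (fun t => (Θ t - Φ t) / (2 * Real.pi)) (Set.Icc 0 (2 * Real.pi))
      (Set.range ((↑) : ℤ → ℝ)) := fun t ht => hint t ht
  have hdisc : IsDiscrete (Set.range ((↑) : ℤ → ℝ)) :=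
    ⟨Int.isClosedEmbedding_coe_real.isEmbedding.toHomeomorph.symm.isEmbedding.discreteTopology⟩
  have heq := isPreconnected_Icc.constant_of_mapsTo hdisc hcont hmaps
    (show (0 : ℝ) ∈ Set.Icc 0 (2 * Real.pi) from ⟨le_rfl, by positivity⟩)
    (show 2 * Real.pi ∈ Set.Icc 0 (2 * Real.pi) from ⟨by positivity, le_rfl⟩)
  have h5 : Θ 0 - Φ 0 = Θ (2 * Real.pi) - Φ (2 * Real.pi) := by
    have : (Θ 0 - Φ 0) / (2 * Real.pi) =
      (Θ (2 * Real.pi) - Φ (2 * Real.pi)) / (2 * Real.pi) := heq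
    field_simp at this
    linarith
  rw [windingNumber, hk]
  congr 1
  linarith

/-! ### The polydisk algebra -/

/-- The open polydisk `𝔻ⁿ`. -/
def openPolydisk (n : ℕ) : Set (Fin n → ℂ) := {z | ∀ i, ‖z i‖ < 1}

/-- The closed polydisk. -/
def closedPolydisk (n : ℕ) : Set (Fin n → ℂ) := {z | ∀ i, ‖z i‖ ≤ 1}

/-- The polydisk algebra `A(𝔻ⁿ)`: the continuous functions on the closed polydisk that are
holomorphic in the open polydisk. (The values off the closed polydisk of the function `F`
below play no role, as the open polydisk is an open set.) -/
def polydiskAlgebra (n : ℕ) : Subalgebra ℂ C(closedPolydisk n, ℂ) where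
  carrier := {f | ∃ F : (Fin n → ℂ) → ℂ,
    DifferentiableOn ℂ F (openPolydisk n) ∧ ∀ z : closedPolydisk n, F z = f z}
  mul_mem' := by
    rintro f g ⟨F, hF, hFf⟩ ⟨G, hG, hGg⟩
    exact ⟨F * G, hF.mul hG, fun z => by simp [hFf, hGg]⟩
  add_mem' := by
    rintro f g ⟨F, hF, hFf⟩ ⟨G, hG, hGg⟩
    exact ⟨F + G, hF.add hG, fun z => by simp [hFf, hGg]⟩
  algebraMap_mem' := fun c =>
    ⟨fun _ => c, differentiableOn_const c, fun z => by simp⟩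

/-- The inclusion of the torus `𝕋ⁿ` into the closed polydisk. -/
def torusInclusion (n : ℕ) : C(Fin n → Circle, closedPolydisk n) where
  toFun z := ⟨fun i => (z i : ℂ), fun i => (Circle.norm_coe _).le⟩
  continuous_toFun := by fun_prop

/-- The diagonal map `z ↦ (z, …, z)` from the circle into the closed polydisk. -/
def diagonalInclusion (n : ℕ) : C(Circle, closedPolydisk n) where
  toFun z := ⟨fun _ => (z : ℂ), fun i => (Circle.norm_coe _).le⟩
  continuous_toFun := by fun_prop

/-- The algebra `S = C(𝕋ⁿ) × C(𝕋)`, with the pointwise operations, the maximum of the two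
supremum norms, and pointwise complex conjugation as its involution `star`. -/
abbrev TorusAlgebra (n : ℕ) : Type := C(Fin n → Circle, ℂ) × C(Circle, ℂ)

/-- The ring homomorphism `f ↦ (f|_{𝕋ⁿ}, (z ↦ f(z, …, z))|_𝕋)` from `A(𝔻ⁿ)` to
`C(𝕋ⁿ) × C(𝕋)`. -/
def polydiskEmbedding (n : ℕ) : polydiskAlgebra n →+* TorusAlgebra n where
  toFun f := ((f : C(closedPolydisk n, ℂ)).comp (torusInclusion n),
    (f : C(closedPolydisk n, ℂ)).comp (diagonalInclusion n))
  map_one' := rfl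
  map_mul' _ _ := rfl
  map_zero' := rfl
  map_add' _ _ := rfl

/-- The index `ι(g, h) = w(h)` on the invertible elements of `C(𝕋ⁿ) × C(𝕋)`. -/
def polydiskIndex (n : ℕ) (u : (TorusAlgebra n)ˣ) : ℤ :=
  windingNumber (Units.map (MonoidHom.snd C(Fin n → Circle, ℂ) C(Circle, ℂ)) u)

end PolydiskIndex

end

namespace PolydiskIndex

open Complex ComplexConjugate

/-! The heart is (A4) for the full polydisk algebra; fullness then passes it to `R`. If `f` has no
zeros on the closed polydisk, contracting the diagonal circle to the origin makes its winding number
zero. Conversely, let `f` be zero-free on the torus with diagonal winding number zero. Through each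
`w` in the open polydisk runs an analytic disk of Möbius maps, centred at `w`, with boundary in the
torus. Moving `w` to the origin deforms this boundary within the torus into the diagonal
(`windingNumber_mobius_eq`), so `f` on the disk has winding number zero and `f w ≠ 0` by the
one-variable result `apply_zero_ne_zero_of_windingNumber_eq_zero`. Applying this to `f - f w` as
well bounds `|f|` below by its minimum on the torus, which settles boundary points. The same disks
give injectivity by the maximum principle, and the identity theorem on complex lines gives (A1). -/

/-! ### Algebra and homotopy invariance of the winding number. -/

theorem windingNumber_mul (f g : C(Circle, ℂ)ˣ) :
    windingNumber (f * g) = windingNumber f + windingNumber g := by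
  obtain ⟨Θ, hΘ⟩ := exists_isContinuousArgument f
  obtain ⟨Φ, hΦ⟩ := exists_isContinuousArgument g
  have h : IsContinuousArgument ↑(f * g) (fun t => Θ t + Φ t) := by
    refine ⟨hΘ.1.add hΦ.1, fun t ht => ?_⟩
    simp only [Units.val_mul, ContinuousMap.mul_apply, norm_mul, ofReal_mul, ofReal_add, mul_add,
      Complex.exp_add]
    rw [hΘ.2 t ht, hΦ.2 t ht, ← hΘ.2 t ht, ← hΦ.2 t ht]
    conv_lhs => rw [hΘ.2 t ht, hΦ.2 t ht]
    ring
  have := windingNumber_eq _ h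
  rw [← @Int.cast_inj ℝ, this, Int.cast_add, windingNumber_eq _ hΘ, windingNumber_eq _ hΦ]
  ring

theorem windingNumber_star (f : C(Circle, ℂ)ˣ) : windingNumber (star f) = -windingNumber f := by
  obtain ⟨Θ, hΘ⟩ := exists_isContinuousArgument f
  have h : IsContinuousArgument ↑(star f) (fun t => -Θ t) := by
    refine ⟨hΘ.1.neg, fun t ht => ?_⟩
    simp only [Units.coe_star, ContinuousMap.star_apply, norm_star]
    conv_lhs => rw [hΘ.2 t ht]
    simp [← Complex.exp_conj]
  rw [← @Int.cast_inj ℝ, windingNumber_eq _ h, Int.cast_neg, windingNumber_eq _ hΘ]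
  ring

theorem windingNumber_eq_zero_of_re_pos (f : C(Circle, ℂ)ˣ)
    (hf : ∀ z, 0 < ((f : C(Circle, ℂ)) z).re) : windingNumber f = 0 := by
  have h : IsContinuousArgument f (fun t => arg ((f : C(Circle, ℂ)) (Circle.exp t))) := by
    refine ⟨fun t _ => ContinuousAt.continuousWithinAt ?_, fun t _ => ?_⟩
    · exact (continuousAt_arg (Or.inl (hf _))).comp (f := fun t : ℝ =>
        (f : C(Circle, ℂ)) (Circle.exp t)) (by fun_prop)
    · rw [mul_comm I, norm_mul_exp_arg_mul_I]
  rw [← @Int.cast_inj ℝ, windingNumber_eq _ h, Circle.exp_two_pi, Circle.exp_zero]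
  simp

/-- Rouché's argument: `g / f` stays within distance 1 of 1, hence in the right half-plane. -/
theorem windingNumber_eq_of_norm_sub_lt (f g : C(Circle, ℂ)ˣ)
    (h : ∀ z, ‖(g : C(Circle, ℂ)) z - (f : C(Circle, ℂ)) z‖ < ‖(f : C(Circle, ℂ)) z‖) :
    windingNumber g = windingNumber f := by
  have h1 : windingNumber (g * f⁻¹) = 0 := by
    refine windingNumber_eq_zero_of_re_pos _ fun z => ?_
    have hz := unit_apply_ne_zero f z
    have hi : (↑f⁻¹ : C(Circle, ℂ)) z = ((f : C(Circle, ℂ)) z)⁻¹ :=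
      eq_inv_of_mul_eq_one_right (congrArg (fun g : C(Circle, ℂ) => g z) f.mul_inv)
    have h2 : ‖((g * f⁻¹ : C(Circle, ℂ)ˣ) : C(Circle, ℂ)) z - 1‖ < 1 := by
      rw [Units.val_mul, ContinuousMap.mul_apply, hi, ← div_eq_mul_inv, div_sub_one hz, norm_div,
        div_lt_one (norm_pos_iff.2 hz)]
      exact h z
    have h3 := (abs_re_le_norm _).trans_lt h2
    rw [sub_re, one_re, abs_lt] at h3
    linarith [h3.1]
  have := windingNumber_mul (g * f⁻¹) f
  rwa [inv_mul_cancel_right, h1, zero_add] at this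

theorem exists_pos_forall_le_norm {X : Type*} [TopologicalSpace X] [CompactSpace X] (f : C(X, ℂ))
    (hf : ∀ x, f x ≠ 0) : ∃ ε > 0, ∀ x, ε ≤ ‖f x‖ := by
  rcases isEmpty_or_nonempty X with h | h
  · exact ⟨1, one_pos, fun x => h.elim x⟩
  · obtain ⟨x, -, hx⟩ := isCompact_univ.exists_isMinOn (f := fun x => ‖f x‖)
      Set.univ_nonempty (by fun_prop)
    exact ⟨‖f x‖, norm_pos_iff.2 (hf x), fun y => hx (Set.mem_univ y)⟩

theorem windingNumber_locallyConstant (f : C(Circle, ℂ)ˣ) :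
    ∃ ε > 0, ∀ g : C(Circle, ℂ)ˣ, ‖(g : C(Circle, ℂ)) - f‖ < ε →
      windingNumber g = windingNumber f := by
  obtain ⟨ε, hε, h⟩ := exists_pos_forall_le_norm (f : C(Circle, ℂ)) (unit_apply_ne_zero f)
  exact ⟨ε, hε, fun g hg => windingNumber_eq_of_norm_sub_lt f g fun z =>
    (((g : C(Circle, ℂ)) - f).norm_coe_le_norm z).trans_lt (hg.trans_le (h z))⟩

/-- Currying turns the homotopy into a path of units in the sup norm, along which a locally constant
function is constant. -/
theorem windingNumber_eq_of_homotopy (H : C(unitInterval × Circle, ℂ)) (hH : ∀ p, H p ≠ 0)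
    (f g : C(Circle, ℂ)ˣ) (hf : ∀ z, (f : C(Circle, ℂ)) z = H (0, z))
    (hg : ∀ z, (g : C(Circle, ℂ)) z = H (1, z)) : windingNumber f = windingNumber g := by
  have hu : ∀ t, IsUnit (H.curry t) := fun t =>
    (ContinuousMap.isUnit_iff_forall_ne_zero _).2 fun z => hH (t, z)
  choose u hu using hu
  have hlc : IsLocallyConstant fun t => windingNumber (u t) := by
    rw [IsLocallyConstant.iff_eventually_eq]
    intro t
    obtain ⟨ε, hε, h⟩ := windingNumber_locallyConstant (u t)
    filter_upwards [H.curry.continuous.continuousAt.eventually (Metric.ball_mem_nhds _ hε)]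
      with s hs
    refine h (u s) ?_
    rwa [hu, hu, ← dist_eq_norm]
  have h0 : f = u 0 := Units.ext (ContinuousMap.ext fun z => by rw [hf, hu]; rfl)
  have h1 : g = u 1 := Units.ext (ContinuousMap.ext fun z => by rw [hg, hu]; rfl)
  rw [h0, h1]
  exact hlc.apply_eq_of_isPreconnected isPreconnected_univ (Set.mem_univ _) (Set.mem_univ _)

/-! ### Winding number zero in the disk algebra. -/

instance : Fact (0 < 2 * Real.pi) := ⟨Real.two_pi_pos⟩

theorem exists_polynomial_of_mem_span_fourier {p : C(AddCircle (2 * Real.pi), ℂ)}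
    (hp : p ∈ Submodule.span ℂ (Set.range (@fourier (2 * Real.pi)))) :
    ∃ P Q : Polynomial ℂ, ∀ t : ℝ,
      p (t : AddCircle (2 * Real.pi)) = P.eval (exp (t * I)) + conj (Q.eval (exp (t * I))) := by
  induction hp using Submodule.span_induction with
  | mem x hx =>
    obtain ⟨n, rfl⟩ := hx
    have hpi : (Real.pi : ℂ) ≠ 0 := by exact_mod_cast Real.pi_ne_zero
    have hcoe : ∀ t : ℝ, fourier n (t : AddCircle (2 * Real.pi)) = exp (n * (t * I)) := fun t => by
      rw [fourier_coe_apply]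
      congr 1
      push_cast
      field_simp
    obtain ⟨m, rfl | rfl⟩ := n.eq_nat_or_neg
    · refine ⟨Polynomial.X ^ m, 0, fun t => ?_⟩
      rw [hcoe]
      simp [← Complex.exp_nat_mul]
    · refine ⟨0, Polynomial.X ^ m, fun t => ?_⟩
      rw [hcoe]
      simp [← Complex.exp_nat_mul, ← Complex.exp_conj]
  | zero => exact ⟨0, 0, fun t => by simp⟩
  | add x y _ _ hx hy =>
    obtain ⟨P, Q, h⟩ := hx
    obtain ⟨P', Q', h'⟩ := hy
    refine ⟨P + P', Q + Q', fun t => ?_⟩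
    rw [ContinuousMap.add_apply, h, h']
    simp only [Polynomial.eval_add, map_add]
    ring
  | smul c x _ hx =>
    obtain ⟨P, Q, h⟩ := hx
    -- `Q` enters through its conjugate, so its scalar is conjugated too.
    refine ⟨Polynomial.C c * P, Polynomial.C (conj c) * Q, fun t => ?_⟩
    rw [ContinuousMap.smul_apply, h]
    simp only [Polynomial.eval_mul, Polynomial.eval_C, map_mul, Complex.conj_conj, smul_eq_mul]
    ring

/-- A continuous function with equal values at `0` and `2π` is uniformly close to the real part
of a polynomial in `e ^ (i t)`. -/
theorem exists_polynomial_abs_sub_re_lt {Θ : ℝ → ℝ}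
    (hc : ContinuousOn Θ (Set.Icc 0 (2 * Real.pi))) (h0 : Θ 0 = Θ (2 * Real.pi)) {ε : ℝ}
    (hε : 0 < ε) : ∃ Q : Polynomial ℂ, ∀ t ∈ Set.Ico (0 : ℝ) (2 * Real.pi),
      |Θ t - (Q.eval (exp (t * I))).re| < ε := by
  let v : C(AddCircle (2 * Real.pi), ℂ) :=
    ⟨AddCircle.liftIco (2 * Real.pi) 0 fun t => (Θ t : ℂ), AddCircle.liftIco_continuous
      (by simp [h0]) (by
        rw [zero_add]
        exact continuous_ofReal.comp_continuousOn hc)⟩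
  have hv : v ∈ (Submodule.span ℂ (Set.range (@fourier (2 * Real.pi)))).topologicalClosure := by
    rw [span_fourier_closure_eq_top]; trivial
  obtain ⟨p, hp, hvp⟩ := Metric.mem_closure_iff.1 hv ε hε
  obtain ⟨P, Q, hPQ⟩ := exists_polynomial_of_mem_span_fourier hp
  -- `P + conj Q` and `P + Q` have the same real part.
  refine ⟨P + Q, fun t ht => ?_⟩
  have h1 : v (t : AddCircle (2 * Real.pi)) = Θ t :=
    AddCircle.liftIco_coe_apply (p := 2 * Real.pi) (a := 0) (f := fun t => (Θ t : ℂ)) (by rwa [zero_add])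
  have h2 : ‖(v - p) (t : AddCircle (2 * Real.pi))‖ < ε := by
    rw [dist_eq_norm] at hvp
    exact ((v - p).norm_coe_le_norm _).trans_lt hvp
  rw [ContinuousMap.sub_apply, h1, hPQ] at h2
  simpa using (abs_re_le_norm _).trans_lt h2

/-- Since `|exp (-g)| = exp (-Re g)`, the maximum principle for `exp (-g)` is a minimum principle
for `Re g`. -/
theorem re_pos_of_diffContOnCl {g : ℂ → ℂ} (hg : DiffContOnCl ℂ g (Metric.ball 0 1))
    (hpos : ∀ z : Circle, 0 < (g z).re) : 0 < (g 0).re := by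
  have hcont : Continuous fun z : Circle => (g z).re := by
    refine continuous_re.comp (hg.continuousOn.comp_continuous continuous_subtype_val fun z => ?_)
    rw [closure_ball _ one_ne_zero]
    simp [Circle.norm_coe]
  obtain ⟨z₀, -, hz₀⟩ := isCompact_univ.exists_isMinOn Set.univ_nonempty hcont.continuousOn
  have hd : DiffContOnCl ℂ (fun z => exp (-g z)) (Metric.ball 0 1) :=
    differentiable_exp.comp_diffContOnCl hg.neg
  have h := Complex.norm_le_of_forall_mem_frontier_norm_le (C := Real.exp (-(g z₀).re))
    Metric.isBounded_ball hd (fun z hz => ?_) (subset_closure (Metric.mem_ball_self one_pos))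
  · rw [norm_exp, neg_re, Real.exp_le_exp] at h
    linarith [hpos z₀]
  · rw [frontier_ball _ one_ne_zero, mem_sphere_zero_iff_norm] at hz
    rw [norm_exp, neg_re, Real.exp_le_exp, neg_le_neg_iff]
    exact hz₀ (Set.mem_univ (⟨z, mem_sphere_zero_iff_norm.2 hz⟩ : Circle))

theorem exists_mem_Ico_exp_eq (z : Circle) :
    ∃ t ∈ Set.Ico (0 : ℝ) (2 * Real.pi), Circle.exp t = z := by
  obtain ⟨s, rfl⟩ := Circle.exp_surjective z
  refine ⟨toIcoMod Real.two_pi_pos 0 s, by simpa using toIcoMod_mem_Ico Real.two_pi_pos 0 s, ?_⟩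
  rw [toIcoMod, zsmul_eq_mul]
  exact Circle.periodic_exp.sub_int_mul_eq _

/-- A function in the disk algebra whose restriction to the circle has winding number zero does
not vanish at the origin. -/
theorem apply_zero_ne_zero_of_windingNumber_eq_zero {g : ℂ → ℂ}
    (hg : DiffContOnCl ℂ g (Metric.ball 0 1)) (u : C(Circle, ℂ)ˣ)
    (hu : ∀ z, (u : C(Circle, ℂ)) z = g z) (hw : windingNumber u = 0) : g 0 ≠ 0 := by
  obtain ⟨Θ, hΘ⟩ := exists_isContinuousArgument u
  have h0 : Θ 0 = Θ (2 * Real.pi) := by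
    have := windingNumber_eq u hΘ
    rw [hw, Int.cast_zero, zero_eq_mul] at this
    rcases this with h | h
    · exact absurd h (by positivity)
    · linarith
  -- Error below `π / 2` suffices: on the circle `g * exp (-I * Q)` has argument `Θ - Re Q`, hence
  -- positive real part. Its value at 0 then has positive real part as well, so `g 0 = 0` is
  -- impossible.
  obtain ⟨Q, hQ⟩ := exists_polynomial_abs_sub_re_lt hΘ.1 h0 (half_pos Real.pi_pos)
  intro hg0
  have hpos := re_pos_of_diffContOnCl (g := fun z => g z • exp (-I * Q.eval z))
    (hg.smul ((differentiable_exp.comp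
      ((differentiable_const _).mul Q.differentiable)).diffContOnCl)) fun z => ?_
  · simp [hg0] at hpos
  · obtain ⟨t, ht, rfl⟩ := exists_mem_Ico_exp_eq z
    have hn : 0 < ‖g (Circle.exp t)‖ := by
      rw [← hu]; exact norm_pos_iff.2 (unit_apply_ne_zero u _)
    have hq := abs_lt.1 (hQ t ht)
    set q := Q.eval (exp (t * I)) with hqdef
    have e : g (Circle.exp t) = (‖g (Circle.exp t)‖ : ℂ) * exp (I * Θ t) := by
      rw [← hu]; exact hΘ.2 t ⟨ht.1, ht.2.le⟩
    rw [e, smul_eq_mul, mul_assoc, ← Complex.exp_add, re_ofReal_mul, Circle.coe_exp, ← hqdef,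
      exp_re]
    refine mul_pos hn (mul_pos (Real.exp_pos _) (Real.cos_pos_of_mem_Ioo ?_))
    simpa using ⟨by linarith [hq.1], by linarith [hq.2]⟩

/-! ### Möbius maps of the disk. -/

/-- The automorphism of the unit disk that maps the origin to `w`. -/
noncomputable def mobius (w z : ℂ) : ℂ := (z + w) / (1 + conj w * z)

theorem one_add_conj_mul_ne_zero {w z : ℂ} (hw : ‖w‖ < 1) (hz : ‖z‖ ≤ 1) :
    1 + conj w * z ≠ 0 := by
  intro h
  have h1 : conj w * z = -1 := by linear_combination h
  have h2 : ‖w‖ * ‖z‖ = 1 := by simpa using congrArg norm h1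
  nlinarith [norm_nonneg w, norm_nonneg z]

theorem mobius_zero (w : ℂ) : mobius w 0 = w := by simp [mobius]

theorem zero_mobius (z : ℂ) : mobius 0 z = z := by simp [mobius]

/-- The sign of the right side decides whether `mobius w z` lies inside or on the unit circle. -/
theorem norm_one_add_conj_mul_sq_sub (w z : ℂ) :
    ‖1 + conj w * z‖ ^ 2 - ‖z + w‖ ^ 2 = (1 - ‖z‖ ^ 2) * (1 - ‖w‖ ^ 2) := by
  simp only [← normSq_eq_norm_sq, normSq_apply, add_re, add_im, mul_re, mul_im, conj_re, conj_im,
    one_re, one_im]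
  ring

theorem norm_mobius_lt_one {w z : ℂ} (hw : ‖w‖ < 1) (hz : ‖z‖ < 1) : ‖mobius w z‖ < 1 := by
  rw [mobius, norm_div, div_lt_one (norm_pos_iff.2 (one_add_conj_mul_ne_zero hw hz.le))]
  refine lt_of_pow_lt_pow_left₀ 2 (norm_nonneg _) ?_
  have : 0 < (1 - ‖z‖ ^ 2) * (1 - ‖w‖ ^ 2) :=
    mul_pos (by nlinarith [norm_nonneg z]) (by nlinarith [norm_nonneg w])
  linarith [norm_one_add_conj_mul_sq_sub w z]

theorem norm_mobius_le_one {w z : ℂ} (hw : ‖w‖ < 1) (hz : ‖z‖ ≤ 1) : ‖mobius w z‖ ≤ 1 := by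
  rw [mobius, norm_div, div_le_one (norm_pos_iff.2 (one_add_conj_mul_ne_zero hw hz))]
  refine le_of_sq_le_sq ?_ (norm_nonneg _)
  have : 0 ≤ (1 - ‖z‖ ^ 2) * (1 - ‖w‖ ^ 2) :=
    mul_nonneg (by nlinarith [norm_nonneg z]) (by nlinarith [norm_nonneg w])
  linarith [norm_one_add_conj_mul_sq_sub w z]

theorem norm_mobius_eq_one {w z : ℂ} (hw : ‖w‖ < 1) (hz : ‖z‖ = 1) : ‖mobius w z‖ = 1 := by
  rw [mobius, norm_div, div_eq_one_iff_eq (norm_ne_zero_iff.2 (one_add_conj_mul_ne_zero hw hz.le))]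
  refine (sq_eq_sq₀ (norm_nonneg _) (norm_nonneg _)).1 ?_
  have := norm_one_add_conj_mul_sq_sub w z
  rw [hz] at this
  linarith

theorem differentiableAt_mobius {w z : ℂ} (hw : ‖w‖ < 1) (hz : ‖z‖ ≤ 1) :
    DifferentiableAt ℂ (mobius w) z :=
  DifferentiableAt.div (by fun_prop) (by fun_prop) (one_add_conj_mul_ne_zero hw hz)

/-! ### Topology of the polydisk. -/

theorem openPolydisk_eq_pi (n : ℕ) :
    openPolydisk n = Set.univ.pi fun _ => Metric.ball (0 : ℂ) 1 := by
  ext z; simp [openPolydisk]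

theorem isOpen_openPolydisk (n : ℕ) : IsOpen (openPolydisk n) := by
  rw [openPolydisk_eq_pi]
  exact isOpen_set_pi Set.finite_univ fun _ _ => Metric.isOpen_ball

theorem convex_openPolydisk (n : ℕ) : Convex ℝ (openPolydisk n) := by
  rw [openPolydisk_eq_pi]
  exact convex_pi fun _ _ => convex_ball _ _

theorem openPolydisk_subset_closedPolydisk (n : ℕ) : openPolydisk n ⊆ closedPolydisk n :=
  fun _ hz i => (hz i).le

theorem dense_openPolydisk (n : ℕ) :
    Dense {z : closedPolydisk n | (z : Fin n → ℂ) ∈ openPolydisk n} := by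
  rw [Subtype.dense_iff]
  intro z hz
  have h : (Subtype.val '' {z : closedPolydisk n | (z : Fin n → ℂ) ∈ openPolydisk n}) =
      openPolydisk n := by
    ext z
    exact ⟨by rintro ⟨y, hy, rfl⟩; exact hy,
      fun h => ⟨⟨z, openPolydisk_subset_closedPolydisk n h⟩, h, rfl⟩⟩
  rw [h, openPolydisk_eq_pi, closure_pi_set]
  intro i _
  rw [closure_ball _ one_ne_zero, mem_closedBall_zero_iff]
  exact hz i

instance (n : ℕ) : CompactSpace (closedPolydisk n) := by
  rw [← isCompact_iff_compactSpace]
  have : closedPolydisk n = Set.univ.pi fun _ => Metric.closedBall (0 : ℂ) 1 := by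
    ext z; simp [closedPolydisk]
  rw [this]
  exact isCompact_univ_pi fun _ => isCompact_closedBall _ _

/-! ### Analytic disks with boundary in the torus. -/

variable {n : ℕ}

/-- The analytic disk through `w`, with center `w` and boundary in the torus. -/
noncomputable def mobiusDisk (w : Fin n → ℂ) (z : ℂ) : Fin n → ℂ := fun i => mobius (w i) z

theorem mobiusDisk_mem_closedPolydisk {w : Fin n → ℂ} (hw : w ∈ openPolydisk n) {z : ℂ}
    (hz : ‖z‖ ≤ 1) : mobiusDisk w z ∈ closedPolydisk n := fun i => norm_mobius_le_one (hw i) hz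

theorem mobiusDisk_zero (w : Fin n → ℂ) : mobiusDisk w 0 = w := funext fun _ => mobius_zero _

/-- The boundary values of `mobiusDisk`. -/
noncomputable def mobiusTorus {w : Fin n → ℂ} (hw : w ∈ openPolydisk n) (z : Circle) :
    Fin n → Circle :=
  fun i => ⟨mobius (w i) z, mem_sphere_zero_iff_norm.2 (norm_mobius_eq_one (hw i) z.norm_coe)⟩

theorem smul_mem_openPolydisk {w : Fin n → ℂ} (hw : w ∈ openPolydisk n) (t : unitInterval) :
    (fun i => ((t : ℝ) : ℂ) * w i) ∈ openPolydisk n := fun i => by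
  rw [norm_mul, norm_real, Real.norm_of_nonneg t.2.1]
  nlinarith [hw i, norm_nonneg (w i), t.2.1, t.2.2]

theorem continuous_mobiusTorus {w : Fin n → ℂ} (hw : w ∈ openPolydisk n) :
    Continuous fun p : unitInterval × Circle => mobiusTorus (smul_mem_openPolydisk hw p.1) p.2 := by
  refine continuous_pi fun i => Continuous.subtype_mk (Continuous.div ?_ ?_ fun p => ?_) _
  · fun_prop
  · have : Continuous fun p : unitInterval × Circle => conj (((p.1 : ℝ) : ℂ) * w i) :=
      Complex.continuous_conj.comp (by fun_prop)
    exact continuous_const.add (this.mul (by fun_prop))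
  · exact one_add_conj_mul_ne_zero (smul_mem_openPolydisk hw p.1 i) p.2.norm_coe.le

theorem continuousOn_of_eq_coe {f : C(closedPolydisk n, ℂ)} {F : (Fin n → ℂ) → ℂ}
    (h : ∀ z : closedPolydisk n, F z = f z) : ContinuousOn F (closedPolydisk n) := by
  rw [continuousOn_iff_continuous_domRestrict]
  convert f.continuous using 1
  exact funext h

theorem exists_diffContOnCl_mobiusDisk (f : polydiskAlgebra n) {w : Fin n → ℂ}
    (hw : w ∈ openPolydisk n) : ∃ g : ℂ → ℂ, DiffContOnCl ℂ g (Metric.ball 0 1) ∧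
      g 0 = f.1 ⟨w, openPolydisk_subset_closedPolydisk n hw⟩ ∧
      ∀ z : Circle, g z = f.1 (torusInclusion n (mobiusTorus hw z)) := by
  obtain ⟨f, F, hF, hFf⟩ := f
  refine ⟨fun z => F (mobiusDisk w z), ⟨?_, ?_⟩, ?_, fun z => ?_⟩
  · refine hF.comp (differentiableOn_pi.2 fun i z hz => ?_) fun z hz i => ?_
    · exact (differentiableAt_mobius (hw i) (mem_ball_zero_iff.1 hz).le).differentiableWithinAt
    · exact norm_mobius_lt_one (hw i) (mem_ball_zero_iff.1 hz)
  · rw [closure_ball _ one_ne_zero]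
    refine (continuousOn_of_eq_coe hFf).comp (continuousOn_pi.2 fun i z hz => ?_) fun z hz => ?_
    · exact (differentiableAt_mobius (hw i)
        (mem_closedBall_zero_iff.1 hz)).continuousAt.continuousWithinAt
    · exact mobiusDisk_mem_closedPolydisk hw (mem_closedBall_zero_iff.1 hz)
  · simp only [mobiusDisk_zero]
    exact hFf ⟨w, _⟩
  · exact hFf (torusInclusion n (mobiusTorus hw z))

/-- A function in the polydisk algebra that vanishes on the torus is zero. -/
theorem eq_zero_of_torus_eq_zero (f : polydiskAlgebra n)
    (hf : ∀ z, f.1 (torusInclusion n z) = 0) : f = 0 := by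
  refine Subtype.ext (DFunLike.coe_injective
    (f.1.continuous.ext_on (dense_openPolydisk n) continuous_const fun w hw => ?_))
  obtain ⟨g, hg, hg0, hgz⟩ := exists_diffContOnCl_mobiusDisk f hw
  -- Maximum principle on the disk centred at `w`, whose boundary lies in the torus.
  have h := Complex.norm_le_of_forall_mem_frontier_norm_le (C := 0) Metric.isBounded_ball hg
    (fun z hz => ?_) (subset_closure (Metric.mem_ball_self one_pos))
  · rw [hg0] at h
    exact norm_le_zero_iff.1 h
  · rw [frontier_ball _ one_ne_zero, mem_sphere_zero_iff_norm] at hz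
    rw [show g z = 0 from (hgz ⟨z, mem_sphere_zero_iff_norm.2 hz⟩).trans (hf _), norm_zero]

/-- The disks centred at `t w` interpolate: at `t = 0` the Möbius maps are the identity and the
boundary is the diagonal. The loops never leave the torus, where `f` has no zeros. -/
theorem windingNumber_mobius_eq (f : polydiskAlgebra n)
    (hf : ∀ z, f.1 (torusInclusion n z) ≠ 0) {w : Fin n → ℂ} (hw : w ∈ openPolydisk n)
    (u v : C(Circle, ℂ)ˣ) (hu : ∀ z, (u : C(Circle, ℂ)) z = f.1 (diagonalInclusion n z))
    (hv : ∀ z, (v : C(Circle, ℂ)) z = f.1 (torusInclusion n (mobiusTorus hw z))) :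
    windingNumber u = windingNumber v := by
  refine windingNumber_eq_of_homotopy ⟨fun p => f.1 (torusInclusion n
    (mobiusTorus (smul_mem_openPolydisk hw p.1) p.2)), ?_⟩ (fun p => hf _) u v
    (fun z => ?_) fun z => ?_
  · exact f.1.continuous.comp ((torusInclusion n).continuous.comp (continuous_mobiusTorus hw))
  · rw [hu]
    refine congrArg f.1 (Subtype.ext (funext fun i => ?_))
    simp [diagonalInclusion, torusInclusion, mobiusTorus, zero_mobius]
  · rw [hv]
    refine congrArg f.1 (Subtype.ext (funext fun i => ?_))
    simp [torusInclusion, mobiusTorus]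

theorem apply_ne_zero_of_mem_openPolydisk (f : polydiskAlgebra n)
    (hf : ∀ z, f.1 (torusInclusion n z) ≠ 0) (u : C(Circle, ℂ)ˣ)
    (hu : ∀ z, (u : C(Circle, ℂ)) z = f.1 (diagonalInclusion n z)) (h0 : windingNumber u = 0)
    (w : closedPolydisk n) (hw : (w : Fin n → ℂ) ∈ openPolydisk n) : f.1 w ≠ 0 := by
  obtain ⟨g, hg, hg0, hgz⟩ := exists_diffContOnCl_mobiusDisk f hw
  have hc : Continuous fun z : Circle => g z := by
    refine hg.continuousOn.comp_continuous continuous_subtype_val fun z => ?_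
    rw [closure_ball _ one_ne_zero]
    simp [Circle.norm_coe]
  obtain ⟨v, hv⟩ := (ContinuousMap.isUnit_iff_forall_ne_zero (⟨_, hc⟩ : C(Circle, ℂ))).2
    fun z => by simpa [hgz] using hf _
  have hv' : ∀ z, (v : C(Circle, ℂ)) z = g z := fun z => by rw [hv]; rfl
  have := apply_zero_ne_zero_of_windingNumber_eq_zero hg v hv' <| by
    rw [← windingNumber_mobius_eq f hf hw u v hu fun z => (hv' z).trans (hgz z), h0]
  rwa [hg0] at this

/-- A function in the polydisk algebra without zeros on the torus, whose diagonal has winding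
number zero, has no zeros on the closed polydisk. -/
theorem apply_ne_zero_of_windingNumber_eq_zero (f : polydiskAlgebra n)
    (hf : ∀ z, f.1 (torusInclusion n z) ≠ 0) (u : C(Circle, ℂ)ˣ)
    (hu : ∀ z, (u : C(Circle, ℂ)) z = f.1 (diagonalInclusion n z)) (h0 : windingNumber u = 0)
    (w : closedPolydisk n) : f.1 w ≠ 0 := by
  obtain ⟨δ, hδ, h⟩ := exists_pos_forall_le_norm (f.1.comp (torusInclusion n)) hf
  suffices hle : δ ≤ ‖f.1 w‖ from norm_pos_iff.1 (hδ.trans_le hle)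
  have hcl : IsClosed {w | δ ≤ ‖f.1 w‖} :=
    isClosed_le continuous_const f.1.continuous.norm
  refine hcl.closure_subset_iff.2 (fun w hw => ?_) (dense_openPolydisk n w)
  -- If `|f w| < δ`, then `f - f w` has no zeros on the torus and, by Rouché, the same diagonal
  -- winding number as `f`; so it cannot vanish at `w`, which is absurd.
  by_contra hlt
  rw [Set.mem_ofPred_eq, not_le] at hlt
  have hne : ∀ z, (f - algebraMap ℂ (polydiskAlgebra n) (f.1 w)).1 (torusInclusion n z) ≠ 0 := by
    intro z hz
    have h1 : f.1 (torusInclusion n z) - f.1 w = 0 := hz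
    have h2 : δ ≤ ‖f.1 (torusInclusion n z)‖ := h z
    rw [sub_eq_zero.1 h1] at h2
    exact h2.not_gt hlt
  obtain ⟨v, hv⟩ := (ContinuousMap.isUnit_iff_forall_ne_zero
    ((f - algebraMap ℂ (polydiskAlgebra n) (f.1 w)).1.comp (diagonalInclusion n))).2
    fun z => hne fun _ => z
  have hv' : ∀ z, (v : C(Circle, ℂ)) z = f.1 (diagonalInclusion n z) - f.1 w := fun z => by
    rw [hv]; rfl
  refine apply_ne_zero_of_mem_openPolydisk _ hne v (fun z => by rw [hv]; rfl) ?_ w hw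
    (sub_self (f.1 w))
  rw [windingNumber_eq_of_norm_sub_lt u v fun z => ?_, h0]
  rw [hv', hu, sub_sub_cancel_left, norm_neg]
  exact hlt.trans_le (h fun _ => z)

/-! ### Units have index zero. -/

theorem windingNumber_eq_zero_of_const (u : C(Circle, ℂ)ˣ) (c : ℂ)
    (hu : ∀ z, (u : C(Circle, ℂ)) z = c) : windingNumber u = 0 := by
  have h : IsContinuousArgument u fun _ => arg c :=
    ⟨continuousOn_const, fun t _ => by rw [hu, mul_comm I, norm_mul_exp_arg_mul_I]⟩
  rw [← @Int.cast_inj ℝ, windingNumber_eq _ h]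
  simp

theorem windingNumber_eq_zero_of_forall_ne_zero (f : C(closedPolydisk n, ℂ)) (hf : ∀ z, f z ≠ 0)
    (u : C(Circle, ℂ)ˣ) (hu : ∀ z, (u : C(Circle, ℂ)) z = f (diagonalInclusion n z)) :
    windingNumber u = 0 := by
  have hmem : ∀ p : unitInterval × Circle,
      (fun _ => ((p.1 : ℝ) : ℂ) * p.2) ∈ closedPolydisk n := fun p i => by
    rw [norm_mul, norm_real, Real.norm_of_nonneg p.1.2.1, p.2.norm_coe, mul_one]
    exact p.1.2.2
  -- Radial contraction of the diagonal circle to the origin.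
  let H : C(unitInterval × Circle, ℂ) := f.comp ⟨fun p => ⟨_, hmem p⟩, by fun_prop⟩
  have hH : ∀ p, H p ≠ 0 := fun p => hf _
  obtain ⟨v, hv⟩ := (ContinuousMap.isUnit_iff_forall_ne_zero (H.curry 0)).2 fun z => hH (0, z)
  have hv' : ∀ z, (v : C(Circle, ℂ)) z = H (0, z) := fun z => by rw [hv]; rfl
  rw [← windingNumber_eq_of_homotopy H hH v u hv' fun z => ?_]
  · refine windingNumber_eq_zero_of_const v (f ⟨0, fun i => by simp⟩) fun z => ?_
    rw [hv']
    refine congrArg f (Subtype.ext (funext fun i => ?_))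
    simp
  · rw [hu]
    refine congrArg f (Subtype.ext (funext fun i => ?_))
    simp [diagonalInclusion]

/-! ### Ring structure of the two algebras. -/

theorem isUnit_polydiskAlgebra_iff (f : polydiskAlgebra n) : IsUnit f ↔ ∀ z, f.1 z ≠ 0 := by
  constructor
  · exact fun h => (ContinuousMap.isUnit_iff_forall_ne_zero f.1).1
      (h.map (polydiskAlgebra n).val)
  · intro h
    obtain ⟨v, hv⟩ := (ContinuousMap.isUnit_iff_forall_ne_zero f.1).2 h
    obtain ⟨F, hF, hFf⟩ := f.2
    have hinv : ∀ z : closedPolydisk n, F z * (↑v⁻¹ : C(closedPolydisk n, ℂ)) z = 1 := fun z => by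
      rw [hFf, ← hv]
      exact congrArg (fun g : C(closedPolydisk n, ℂ) => g z) v.mul_inv
    have hmem : (↑v⁻¹ : C(closedPolydisk n, ℂ)) ∈ polydiskAlgebra n :=
      ⟨fun z => (F z)⁻¹, hF.inv fun z hz => by
        have := h ⟨z, openPolydisk_subset_closedPolydisk n hz⟩
        rwa [← hFf] at this, fun z => inv_eq_of_mul_eq_one_right (hinv z)⟩
    refine IsUnit.of_mul_eq_one ⟨_, hmem⟩ (Subtype.ext ?_)
    change f.1 * ↑v⁻¹ = 1
    rw [← hv, v.mul_inv]

instance : NoZeroDivisors (polydiskAlgebra n) where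
  eq_zero_or_eq_zero_of_mul_eq_zero := by
    rintro ⟨f, F, hF, hFf⟩ ⟨g, G, hG, hGg⟩ h
    by_contra! hne
    obtain ⟨hf, hg⟩ := hne
    have hfg : ∀ z ∈ openPolydisk n, F z * G z = 0 := fun z hz => by
      have hz' := openPolydisk_subset_closedPolydisk n hz
      rw [hFf ⟨z, hz'⟩, hGg ⟨z, hz'⟩]
      exact congrArg (fun k : polydiskAlgebra n => k.1 ⟨z, hz'⟩) h
    obtain ⟨a, ha, hFa⟩ : ∃ a ∈ openPolydisk n, F a ≠ 0 := by
      by_contra! h0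
      refine hf (Subtype.ext (DFunLike.coe_injective
        (f.continuous.ext_on (dense_openPolydisk n) continuous_const fun w hw => ?_)))
      exact (hFf w).symm.trans (h0 w hw)
    refine hg (Subtype.ext (DFunLike.coe_injective
      (g.continuous.ext_on (dense_openPolydisk n) continuous_const fun b hb => ?_)))
    -- On the complex line through `a` and `b`, `F` is nonzero near `a`, so `G` vanishes there. The
    -- line meets the polydisk in a convex set, so the identity theorem carries this to `b`.
    let l : ℂ → Fin n → ℂ := fun t => a + t • ((b : Fin n → ℂ) - a)
    have hl : Differentiable ℂ l := by fun_prop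
    have hU : IsOpen (l ⁻¹' openPolydisk n) := (isOpen_openPolydisk n).preimage hl.continuous
    have hconv : Convex ℝ (l ⁻¹' openPolydisk n) := by
      intro x hx y hy s t hs ht hst
      have : l (s • x + t • y) = s • l x + t • l y := by
        ext i
        have hst' : (s : ℂ) + t = 1 := by exact_mod_cast hst
        simp only [l, Pi.add_apply, Pi.smul_apply, Pi.sub_apply, smul_eq_mul, real_smul]
        linear_combination -a i * hst'
      rw [Set.mem_preimage, this]
      exact convex_openPolydisk n hx hy hs ht hst
    have h0 : (0 : ℂ) ∈ l ⁻¹' openPolydisk n := by simpa [l] using ha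
    have h1 : (1 : ℂ) ∈ l ⁻¹' openPolydisk n := by simpa [l] using hb
    have hcont : ContinuousAt (F ∘ l) 0 :=
      ((hF.comp hl.differentiableOn fun _ h => h).continuousOn).continuousAt (hU.mem_nhds h0)
    have han : AnalyticOnNhd ℂ (G ∘ l) (l ⁻¹' openPolydisk n) :=
      (hG.comp hl.differentiableOn fun _ h => h).analyticOnNhd hU
    have hev : G ∘ l =ᶠ[nhds 0] 0 := by
      filter_upwards [hU.mem_nhds h0, hcont.eventually_ne (by simpa [l] using hFa)] with t ht hFt
      exact (mul_eq_zero.1 (hfg _ ht)).resolve_left hFt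
    have := han.eqOn_zero_of_preconnected_of_eventuallyEq_zero hconv.isPreconnected h0 hev h1
    rw [← hGg b]
    simpa [l] using this

instance : Nontrivial (polydiskAlgebra n) :=
  ⟨0, 1, fun h => zero_ne_one
    (congrArg (fun k : polydiskAlgebra n => k.1 ⟨0, fun i => by simp⟩) h)⟩

/-- If a component is nonzero at `z`, a constant multiple of it plus 1 vanishes at `z` and is not a
unit. -/
theorem jacobson_torusAlgebra_eq_bot (n : ℕ) : Ring.jacobson (TorusAlgebra n) = ⊥ := by
  rw [← Ideal.jacobson_bot, eq_bot_iff]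
  rintro ⟨g, h⟩ hx
  rw [Ideal.mem_jacobson_bot] at hx
  rw [Ideal.mem_bot, Prod.mk_eq_zero]
  constructor
  · ext z
    by_contra hz
    have := (hx (ContinuousMap.const _ (-(g z)⁻¹), 0)).map (RingHom.fst _ _)
    refine (ContinuousMap.isUnit_iff_forall_ne_zero _).1 this z ?_
    change g z * -(g z)⁻¹ + 1 = 0
    rw [mul_neg, mul_inv_cancel₀ hz, neg_add_cancel]
  · ext z
    by_contra hz
    have := (hx (0, ContinuousMap.const _ (-(h z)⁻¹))).map (RingHom.snd _ _)
    refine (ContinuousMap.isUnit_iff_forall_ne_zero _).1 this z ?_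
    change h z * -(h z)⁻¹ + 1 = 0
    rw [mul_neg, mul_inv_cancel₀ hz, neg_add_cancel]

theorem polydiskEmbedding_injective (n : ℕ) : Function.Injective (polydiskEmbedding n) := by
  rw [injective_iff_map_eq_zero]
  intro f hf
  exact eq_zero_of_torus_eq_zero f fun z =>
    congrArg (fun p : TorusAlgebra n => p.1 z) hf

theorem isUnit_polydiskAlgebra_iff_polydiskIndex_eq_zero (f : polydiskAlgebra n)
    (u : (TorusAlgebra n)ˣ) (hu : (u : TorusAlgebra n) = polydiskEmbedding n f) :
    IsUnit f ↔ polydiskIndex n u = 0 := by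
  have hdiag : ∀ z, (Units.map (MonoidHom.snd C(Fin n → Circle, ℂ) C(Circle, ℂ)) u :
      C(Circle, ℂ)) z = f.1 (diagonalInclusion n z) := fun z =>
    congrArg (fun p : TorusAlgebra n => p.2 z) hu
  rw [isUnit_polydiskAlgebra_iff]
  refine ⟨fun h => windingNumber_eq_zero_of_forall_ne_zero f.1 h _ hdiag, fun h => ?_⟩
  refine apply_ne_zero_of_windingNumber_eq_zero f (fun z => ?_) _ hdiag h
  have h1 := (ContinuousMap.isUnit_iff_forall_ne_zero _).1
    (u.isUnit.map (RingHom.fst C(Fin n → Circle, ℂ) C(Circle, ℂ))) z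
  rwa [hu] at h1

end PolydiskIndex

open PolydiskIndex in
theorem mainTheorem7 (n : ℕ) (R : Subring (PolydiskIndex.polydiskAlgebra n))
    (hR : PolydiskIndex.IsFullSubring R) :
    PolydiskIndex.SatisfiesA1A4 ((PolydiskIndex.polydiskEmbedding n).comp R.subtype)
      (PolydiskIndex.polydiskIndex n) where
  a1 := by
    have : IsDomain (polydiskAlgebra n) := NoZeroDivisors.to_isDomain _
    infer_instance
  a2_complete := inferInstance
  a2_norm_one := norm_one
  a2_semisimple := jacobson_torusAlgebra_eq_bot n
  a2_star_smul c a := star_smul c a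
  a2_injective := (polydiskEmbedding_injective n).comp Subtype.val_injective
  a3_mul a b := by rw [polydiskIndex, map_mul, windingNumber_mul]; rfl
  a3_star a := by
    rw [polydiskIndex, polydiskIndex, ← windingNumber_star]
    exact congrArg windingNumber (Units.ext rfl)
  a3_locallyConstant a := by
    obtain ⟨ε, hε, h⟩ := windingNumber_locallyConstant (Units.map (MonoidHom.snd _ _) a)
    exact ⟨ε, hε, fun b hb => h _ ((norm_snd_le ((b : TorusAlgebra n) - (a : TorusAlgebra n))).trans_lt hb)⟩
  a4 x u hu := by
    rw [← isUnit_polydiskAlgebra_iff_polydiskIndex_eq_zero x.1 u hu]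
    -- Fullness identifies invertibility in `R` with invertibility in the polydisk algebra.
    exact ⟨fun h => h.map R.subtype, hR x⟩
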